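/- Let $L\ge 1$ be an integer and let $\alpha>0$. For $\ell=1,\dots,L$ let $T_\ell>0$, $\hat r_\ell>0$ and let $(\varphi_{i,\ell})_{i\ge 0}$ be a real sequence with $\varphi_{0,\ell}\neq 0$. Let $R_1,\dots,R_L$ be independent (not necessarily identically distributed) random variables with support in $[0,\infty)$ such that each $R_\ell$ is an $\alpha$-$\mu$ mixture, that is, it has the probability density $$f_{R_\ell}(r)=\alpha\exp\!\left(-\frac{r^\alpha}{\hat r_\ell^{\alpha}}\right)\sum_{i=0}^{\infty}\frac{\varphi_{i,\ell}\,r^{\alpha(i+T_\ell)-1}}{\hat r_\ell^{\alpha(i+T_\ell)}\,\Gamma(i+T_\ell)}\ \ (r>0),$$ where the series converges absolutely for every $r>0$ and $f_{R_\ell}\ge 0$ there. Let $R=\sum_{\ell=1}^{L}R_\ell$. Define, for $i\ge 0$, $$\lambda_{i,\ell}=\frac{\Gamma(\alpha(i+T_\ell))}{\hat r_\ell^{\alpha i}}\sum_{j=0}^{i}\frac{(-1)^{i-j}\varphi_{j,\ell}}{(i-j)!\,\Gamma(j+T_\ell)},$$ $$\phi_{0,\ell}=\frac{\lambda_{1,\ell}}{\lambda_{0,\ell}},\qquad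 \phi_{h,\ell}=\frac{1}{\lambda_{0,\ell}}\left[(h+1)\lambda_{h+1,\ell}-\sum_{t=1}^{h}\lambda_{t,\ell}\,\phi_{h-t,\ell}\right]\ (h\ge 1),$$ $$\delta_0=\prod_{\ell=1}^{L}\lambda_{0,\ell},\qquad \delta_i=\frac1i\sum_{h=1}^{i}\delta_{i-h}\sum_{\ell=1}^{L}\phi_{h-1,\ell}\ (i\ge 1).$$ Then $R$ has a probability density $f_R$, supported on $[0,\infty)$, and a cumulative distribution function $F_R$, given by $$f_R(r)=\alpha^L\left(\prod_{\ell=1}^{L}\frac{1}{\hat r_\ell^{\alpha T_\ell}}\right)\sum_{i=0}^{\infty}\frac{\delta_i\,r^{-1+\alpha i+\alpha\sum_{\ell=1}^{L} T_\ell}}{\Gamma\!\left(i\alpha+\alpha\sum_{\ell=1}^{L} T_\ell\right)}\ \ (r>0),$$ $$F_R(r)=\alpha^L\left(\prod_{\ell=1}^{L}\frac{1}{\hat r_\ell^{\alpha T_\ell}}\right)\sum_{i=0}^{\infty}\frac{\delta_i\,r^{\alpha i+\alpha\sum_{\ell=1}^{L} T_\ell}}{\Gamma\!\left(1+i\alpha+\alpha\sum_{\ell=1}^{L}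 T_\ell\right)}\ \ (r\ge 0),$$ where both series converge absolutely for all such $r$. -/

import Mathlib

open MeasureTheory ProbabilityTheory

noncomputable section

namespace AlphaMu

/-- The random variable `X` is supported on `[0, ∞)` and has the (nonnegative) probability density
`f` there: `X` has a density with respect to Lebesgue measure, equal to `f r` for almost every
`r > 0` and to `0` for almost every `r ≤ 0`. -/
structure HasPosDensity {Ω : Type*} [MeasurableSpace Ω] (P : Measure Ω) (X : Ω → ℝ)
    (f : ℝ → ℝ) : Prop where
  hasPDF : HasPDF X P volume
  nonneg : ∀ r : ℝ, 0 < r → 0 ≤ f r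
  pdf_ae : pdf X P volume =ᵐ[volume] fun r => ENNReal.ofReal (if 0 < r then f r else 0)

/-- The `i`-th term of the series in the density of an α-μ mixture. -/
def mixtureTerm (α T rhat : ℝ) (φ : ℕ → ℝ) (r : ℝ) (i : ℕ) : ℝ :=
  φ i * r ^ (α * (i + T) - 1) / (rhat ^ (α * (i + T)) * Real.Gamma (i + T))

/-- The density of an α-μ mixture. -/
def mixtureDensity (α T rhat : ℝ) (φ : ℕ → ℝ) (r : ℝ) : ℝ :=
  α * Real.exp (-(r ^ α / rhat ^ α)) * ∑' i : ℕ, mixtureTerm α T rhat φ r i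

/-- `X` is an α-μ mixture with the given parameters: the series defining the density converges
at every `r > 0`, and its value is the probability density of `X`. -/
structure IsMixture {Ω : Type*} [MeasurableSpace Ω] (P : Measure Ω) (X : Ω → ℝ)
    (α T rhat : ℝ) (φ : ℕ → ℝ) : Prop where
  summable : ∀ r : ℝ, 0 < r → Summable (mixtureTerm α T rhat φ r)
  density : HasPosDensity P X (mixtureDensity α T rhat φ)

/-- The coefficients `λ_i`. -/
def lam (α T rhat : ℝ) (φ : ℕ → ℝ) (i : ℕ) : ℝ :=
  Real.Gamma (α * (i + T)) / rhat ^ (α * i) *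
    ∑ j ∈ Finset.range (i + 1),
      (-1) ^ (i - j) * φ j / (((i - j).factorial : ℝ) * Real.Gamma (j + T))

/-- The auxiliary coefficients `ϕ_h` attached to a sequence `η`; the sum is over `1 ≤ t ≤ h`,
shifted by one. -/
def phiCoeff (η : ℕ → ℝ) (h : ℕ) : ℝ :=
  1 / η 0 * (((h : ℝ) + 1) * η (h + 1) - ∑ t : Fin h, η (t + 1) * phiCoeff η (h - (t + 1)))
termination_by h
decreasing_by omega

/-- The coefficients `δ_i` attached to finitely many sequences `η ℓ`; in the recursion the sum is
over `1 ≤ h ≤ i`, shifted by one. -/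
def deltaCoeff {L : ℕ} (η : Fin L → ℕ → ℝ) : ℕ → ℝ
  | 0 => ∏ ℓ, η ℓ 0
  | i + 1 => 1 / ((i : ℝ) + 1) *
      ∑ h : Fin (i + 1), deltaCoeff η (i - h) * ∑ ℓ, phiCoeff (η ℓ) h
termination_by i => i
decreasing_by omega

theorem phiCoeff_zero (η : ℕ → ℝ) : phiCoeff η 0 = η 1 / η 0 := by
  rw [phiCoeff]
  simp [div_eq_inv_mul]

theorem phiCoeff_eq (η : ℕ → ℝ) (h : ℕ) :
    phiCoeff η h = 1 / η 0 *
      (((h : ℝ) + 1) * η (h + 1) - ∑ t ∈ Finset.Icc 1 h, η t * phiCoeff η (h - t)) := by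
  rw [phiCoeff, Fin.sum_univ_eq_sum_range (fun t => η (t + 1) * phiCoeff η (h - (t + 1))),
    Finset.range_eq_Ico, Finset.sum_Ico_add' (fun t => η t * phiCoeff η (h - t)) 0 h 1]
  rfl

theorem deltaCoeff_zero {L : ℕ} (η : Fin L → ℕ → ℝ) : deltaCoeff η 0 = ∏ ℓ, η ℓ 0 := by
  rw [deltaCoeff]

theorem deltaCoeff_eq {L : ℕ} (η : Fin L → ℕ → ℝ) (i : ℕ) (hi : 1 ≤ i) :
    deltaCoeff η i = 1 / (i : ℝ) *
      ∑ h ∈ Finset.Icc 1 i, deltaCoeff η (i - h) * ∑ ℓ, phiCoeff (η ℓ) (h - 1) := by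
  obtain ⟨i, rfl⟩ := Nat.exists_eq_add_of_le' hi
  have e : ∑ h ∈ Finset.range (i + 1), deltaCoeff η (i - h) * ∑ ℓ, phiCoeff (η ℓ) h =
      ∑ h ∈ Finset.Icc 1 (i + 1),
        deltaCoeff η (i + 1 - h) * ∑ ℓ, phiCoeff (η ℓ) (h - 1) := by
    have := Finset.sum_Ico_add'
      (fun h => deltaCoeff η (i + 1 - h) * ∑ ℓ, phiCoeff (η ℓ) (h - 1)) 0 (i + 1) 1
    rw [Finset.range_eq_Ico]
    simp only [Nat.add_sub_add_right, Nat.add_sub_cancel] at this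
    exact this
  rw [← e, deltaCoeff,
    ← Fin.sum_univ_eq_sum_range (fun h => deltaCoeff η (i - h) * ∑ ℓ, phiCoeff (η ℓ) h)]
  push_cast
  rfl

end AlphaMu

end

/-! The kernels `k_a(r) = r ^ (a - 1) / Γ(a)` form a convolution semigroup, `k_a * k_b = k_{a+b}`:
this is Euler's Beta integral (`integral_powerKernel_mul`). Expanding the exponential and taking a
Cauchy product writes each mixture density as a series in `k_{αi + αT}` with coefficients
proportional to `lam` (`IsMixture.hasSeriesDensity`). Convolving two such series therefore
multiplies their coefficient sequences as formal power series (`HasSeriesDensity.add`), and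
integrating from `0` to `r` turns `k_a` into `k_{a+1}` (`HasSeriesDensity.cdf_eq`).

Termwise integration is justified by `powerKernel_add_le`, which dominates the double series at `z`
by the product of the two given series at the same `z`.

It remains to identify the product of the coefficient series with `deltaCoeff`. The recursion for
`phiCoeff` computes a logarithmic derivative, and that for `deltaCoeff` recovers a product from the
sum of the logarithmic derivatives of its factors (`mk_deltaCoeff`). -/

noncomputable section

namespace AlphaMu

/-! ### Termwise integration of series -/

section TermwiseIntegration

variable {β ι : Type*} [MeasurableSpace β] [Countable ι] {μ : Measure β} {F : ι → β → ℝ}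

/-- A pointwise summable series whose integrals of norms are summable has an integrable sum. -/
theorem integrable_tsum_of_summable_integral_norm (hF : ∀ i, Integrable (F i) μ)
    (hF' : Summable fun i => ∫ a, ‖F i a‖ ∂μ) (hs : ∀ᵐ a ∂μ, Summable fun i => F i a) :
    Integrable (fun a => ∑' i, F i a) μ := by
  refine ⟨?_, ?_⟩
  · refine aestronglyMeasurable_of_tendsto_ae Filter.atTop
      (f := fun (s : Finset ι) a => ∑ i ∈ s, F i a) (fun s => ?_) ?_
    · exact (integrable_finsetSum s fun i _ => hF i).aestronglyMeasurable
    · filter_upwards [hs] with a ha using ha.hasSum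
  · calc ∫⁻ a, ‖∑' i, F i a‖ₑ ∂μ ≤ ∫⁻ a, ∑' i, ‖F i a‖ₑ ∂μ :=
          lintegral_mono fun a => enorm_tsum_le_tsum_enorm
      _ = ∑' i, ∫⁻ a, ‖F i a‖ₑ ∂μ := lintegral_tsum fun i => (hF i).aestronglyMeasurable.enorm
      _ = ∑' i, ENNReal.ofReal (∫ a, ‖F i a‖ ∂μ) := by
          congr 1; ext i; rw [ofReal_integral_norm_eq_lintegral_enorm (hF i)]
      _ < ⊤ := by
          rw [← ENNReal.ofReal_tsum_of_nonneg (fun i => integral_nonneg fun a => norm_nonneg _) hF']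
          exact ENNReal.ofReal_lt_top

/-- Termwise integration of a series with nonnegative sum. -/
theorem lintegral_ofReal_tsum (hF : ∀ i, Integrable (F i) μ)
    (hF' : Summable fun i => ∫ a, ‖F i a‖ ∂μ) (hs : ∀ᵐ a ∂μ, Summable fun i => F i a)
    (h0 : ∀ᵐ a ∂μ, 0 ≤ ∑' i, F i a) :
    ∫⁻ a, ENNReal.ofReal (∑' i, F i a) ∂μ = ENNReal.ofReal (∑' i, ∫ a, F i a ∂μ) := by
  rw [← ofReal_integral_eq_lintegral_ofReal
    (integrable_tsum_of_summable_integral_norm hF hF' hs) h0,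
    (hasSum_integral_of_summable_integral_norm hF hF').tsum_eq]

end TermwiseIntegration

/-! ### The kernel, its semigroup law and its bounds -/

/-- The Riemann–Liouville kernel `r ^ (a - 1) / Γ(a)`. -/
def powerKernel (a r : ℝ) : ℝ := r ^ (a - 1) / Real.Gamma a

theorem powerKernel_nonneg {a r : ℝ} (ha : 0 < a) (hr : 0 ≤ r) : 0 ≤ powerKernel a r :=
  div_nonneg (Real.rpow_nonneg hr _) (Real.Gamma_pos_of_pos ha).le

theorem intervalIntegral_rpow_mul_rpow_sub {a b z : ℝ} (ha : 0 < a) (hb : 0 < b) (hz : 0 < z) :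
    ∫ y in (0 : ℝ)..z, y ^ (a - 1) * (z - y) ^ (b - 1) =
      z ^ (a + b - 1) * (Real.Gamma a * Real.Gamma b / Real.Gamma (a + b)) := by
  have h := Complex.betaIntegral_scaled a b hz
  rw [Complex.betaIntegral_eq_Gamma_mul_div _ _ (by simpa) (by simpa)] at h
  -- Both bases are nonnegative on `[0, z]`, so the complex powers are the real ones.
  have e : ∫ x in (0 : ℝ)..z, (x : ℂ) ^ ((a : ℂ) - 1) * ((z : ℂ) - x) ^ ((b : ℂ) - 1) =
      ∫ x in (0 : ℝ)..z, ((x ^ (a - 1) * (z - x) ^ (b - 1) : ℝ) : ℂ) := by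
    refine intervalIntegral.integral_congr fun x hx => ?_
    rw [Set.uIcc_of_le hz.le] at hx
    rw [Complex.ofReal_mul, Complex.ofReal_cpow hx.1, Complex.ofReal_cpow (sub_nonneg.2 hx.2)]
    push_cast
    rfl
  rw [e, intervalIntegral.integral_ofReal, ← Complex.ofReal_add, Complex.Gamma_ofReal,
    Complex.Gamma_ofReal, Complex.Gamma_ofReal, ← Complex.ofReal_one, ← Complex.ofReal_sub,
    ← Complex.ofReal_cpow hz.le] at h
  exact_mod_cast h

theorem integral_powerKernel_mul {a b z : ℝ} (ha : 0 < a) (hb : 0 < b) (hz : 0 < z) :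
    ∫ y in Set.Ioo 0 z, powerKernel a y * powerKernel b (z - y) = powerKernel (a + b) z := by
  have := Real.Gamma_pos_of_pos ha
  have := Real.Gamma_pos_of_pos hb
  rw [← integral_Ioc_eq_integral_Ioo, ← intervalIntegral.integral_of_le hz.le]
  have e : ∀ y, powerKernel a y * powerKernel b (z - y) =
      (Real.Gamma a * Real.Gamma b)⁻¹ * (y ^ (a - 1) * (z - y) ^ (b - 1)) := fun y => by
    unfold powerKernel; field_simp
  simp_rw [e]
  rw [intervalIntegral.integral_const_mul, intervalIntegral_rpow_mul_rpow_sub ha hb hz,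
    powerKernel]
  field_simp

theorem powerKernel_pos {a r : ℝ} (ha : 0 < a) (hr : 0 < r) : 0 < powerKernel a r :=
  div_pos (Real.rpow_pos_of_pos hr _) (Real.Gamma_pos_of_pos ha)

theorem integrableOn_powerKernel_mul {a b z : ℝ} (ha : 0 < a) (hb : 0 < b) (hz : 0 < z) :
    IntegrableOn (fun y => powerKernel a y * powerKernel b (z - y)) (Set.Ioo 0 z) :=
  -- The Bochner integral of a non-integrable function is `0`, so a nonzero value proves
  -- integrability.
  Integrable.of_integral_ne_zero <| by
    rw [integral_powerKernel_mul ha hb hz]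
    exact (powerKernel_pos (add_pos ha hb) hz).ne'

/-- Both sides are Beta integrals over `(0, 1)`, where the integrand decreases in each exponent. -/
theorem Gamma_mul_Gamma_div_le {a b A B : ℝ} (hA : 0 < A) (hB : 0 < B) (ha : A ≤ a) (hb : B ≤ b) :
    Real.Gamma a * Real.Gamma b / Real.Gamma (a + b) ≤
      Real.Gamma A * Real.Gamma B / Real.Gamma (A + B) := by
  have key := fun {x y : ℝ} (hx : 0 < x) (hy : 0 < y) =>
    intervalIntegral_rpow_mul_rpow_sub hx hy one_pos
  simp only [Real.one_rpow, one_mul] at key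
  have int := fun {x y : ℝ} (hx : 0 < x) (hy : 0 < y) =>
    intervalIntegral.intervalIntegrable_of_integral_ne_zero
      ((key hx hy).trans_ne (beta_pos hx hy).ne')
  have ha0 := hA.trans_le ha
  have hb0 := hB.trans_le hb
  rw [← key ha0 hb0, ← key hA hB]
  refine intervalIntegral.integral_mono_on_of_le_Ioo zero_le_one (int ha0 hb0) (int hA hB) ?_
  intro y hy
  have h1 : 0 < 1 - y := sub_pos.2 hy.2
  exact mul_le_mul (Real.rpow_le_rpow_of_exponent_ge hy.1 hy.2.le (by linarith))
    (Real.rpow_le_rpow_of_exponent_ge h1 (by linarith [hy.1]) (by linarith))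
    (Real.rpow_nonneg h1.le _) (Real.rpow_nonneg hy.1.le _)

/-- The exact ratio of the kernels is `z` times the Beta function of `(a, b)`. Bounding it by the
value at `(A, B)` makes the constant uniform in the summation indices. -/
theorem powerKernel_add_le {a b A B z : ℝ} (hA : 0 < A) (hB : 0 < B) (ha : A ≤ a) (hb : B ≤ b)
    (hz : 0 < z) :
    powerKernel (a + b) z ≤ z * (Real.Gamma A * Real.Gamma B / Real.Gamma (A + B)) *
      (powerKernel a z * powerKernel b z) := by
  have ha0 := Real.Gamma_pos_of_pos (hA.trans_le ha)
  have hb0 := Real.Gamma_pos_of_pos (hB.trans_le hb)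
  have e : z ^ (a + b - 1) = z * (z ^ (a - 1) * z ^ (b - 1)) := by
    rw [show a + b - 1 = 1 + (a - 1) + (b - 1) by ring, Real.rpow_add hz, Real.rpow_add hz,
      Real.rpow_one, mul_assoc]
  calc powerKernel (a + b) z =
      z * (Real.Gamma a * Real.Gamma b / Real.Gamma (a + b)) *
        (powerKernel a z * powerKernel b z) := by
        unfold powerKernel; rw [e]; field_simp
    _ ≤ _ := by
        have := powerKernel_nonneg (hA.trans_le ha) hz.le
        have := powerKernel_nonneg (hB.trans_le hb) hz.le
        exact mul_le_mul_of_nonneg_right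
          (mul_le_mul_of_nonneg_left (Gamma_mul_Gamma_div_le hA hB ha hb) hz.le) (by positivity)

theorem powerKernel_add_one {a z : ℝ} (ha : 0 < a) (hz : 0 < z) :
    powerKernel (a + 1) z = z / a * powerKernel a z := by
  have := Real.Gamma_pos_of_pos ha
  unfold powerKernel
  rw [Real.Gamma_add_one ha.ne', show a + 1 - 1 = 1 + (a - 1) by ring, Real.rpow_add hz,
    Real.rpow_one]
  field_simp

theorem integral_powerKernel {a z : ℝ} (ha : 0 < a) (hz : 0 < z) :
    ∫ y in Set.Ioo 0 z, powerKernel a y = powerKernel (a + 1) z := by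
  -- `powerKernel 1` is the constant `1`, so integrating is convolving with it.
  rw [← integral_powerKernel_mul ha one_pos hz]
  simp [powerKernel]

theorem integrableOn_powerKernel {a z : ℝ} (ha : 0 < a) (hz : 0 < z) :
    IntegrableOn (powerKernel a) (Set.Ioo 0 z) :=
  Integrable.of_integral_ne_zero <| by
    rw [integral_powerKernel ha hz]
    exact (powerKernel_pos (add_pos ha one_pos) hz).ne'

/-- The terms of the series `∑ c i * r ^ (α i + A - 1) / Γ(α i + A)`. -/
def seriesTerm (α A : ℝ) (c : ℕ → ℝ) (r : ℝ) (i : ℕ) : ℝ := c i * powerKernel (α * i + A) r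

/-! ### Convolution of two kernel series -/

section Convolution

variable {α A B : ℝ} {a b : ℕ → ℝ}

theorem exponent_ge (hα : 0 < α) (i : ℕ) : A ≤ α * i + A := by
  have : 0 ≤ α * i := by positivity
  linarith

theorem summable_convolution_terms (hα : 0 < α) (hA : 0 < A) (hB : 0 < B) {z : ℝ} (hz : 0 < z)
    (ha : Summable (seriesTerm α A a z)) (hb : Summable (seriesTerm α B b z)) :
    Summable fun p : ℕ × ℕ =>
      ‖a p.1 * b p.2 * powerKernel (α * p.1 + A + (α * p.2 + B)) z‖ := by
  have h := (summable_mul_of_summable_norm ha.norm hb.norm).norm.mul_left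
    (z * (Real.Gamma A * Real.Gamma B / Real.Gamma (A + B)))
  refine h.of_nonneg_of_le (fun _ => norm_nonneg _) fun p => ?_
  have h1 := exponent_ge (A := A) hα p.1
  have h2 := exponent_ge (A := B) hα p.2
  have h3 := powerKernel_nonneg (hA.trans_le h1) hz.le
  have h4 := powerKernel_nonneg (hB.trans_le h2) hz.le
  have h5 := powerKernel_nonneg (add_pos (hA.trans_le h1) (hB.trans_le h2)) hz.le
  simp only [seriesTerm, norm_mul, Real.norm_of_nonneg h3, Real.norm_of_nonneg h4,
    Real.norm_of_nonneg h5]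
  calc _ ≤ ‖a p.1‖ * ‖b p.2‖ * (z * (Real.Gamma A * Real.Gamma B / Real.Gamma (A + B)) *
      (powerKernel (α * p.1 + A) z * powerKernel (α * p.2 + B) z)) := by
        gcongr
        exact powerKernel_add_le hA hB h1 h2 hz
    _ = _ := by ring

theorem hasSum_convolution_terms (hα : 0 < α) (hA : 0 < A) (hB : 0 < B) {z : ℝ} (hz : 0 < z)
    (ha : Summable (seriesTerm α A a z)) (hb : Summable (seriesTerm α B b z)) :
    HasSum (seriesTerm α (A + B) (fun n => ∑ p ∈ Finset.HasAntidiagonal.antidiagonal n, a p.1 * b p.2) z)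
      (∑' p : ℕ × ℕ, a p.1 * b p.2 * powerKernel (α * p.1 + A + (α * p.2 + B)) z) := by
  have h := (summable_convolution_terms hα hA hB hz ha hb).of_norm.hasSum
  rw [← Finset.HasAntidiagonal.sigmaAntidiagonalEquivProd.hasSum_iff] at h
  have e : seriesTerm α (A + B)
      (fun n => ∑ p ∈ Finset.HasAntidiagonal.antidiagonal n, a p.1 * b p.2) z =
      fun n => ∑ p : Finset.HasAntidiagonal.antidiagonal n, a p.1.1 * b p.1.2 *
        powerKernel (α * p.1.1 + A + (α * p.1.2 + B)) z := by
    funext n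
    rw [seriesTerm, Finset.sum_mul,
      Finset.sum_coe_sort (Finset.HasAntidiagonal.antidiagonal n) (fun p : ℕ × ℕ =>
        a p.1 * b p.2 * powerKernel (α * p.1 + A + (α * p.2 + B)) z)]
    refine Finset.sum_congr rfl fun p hp => ?_
    rw [← Finset.HasAntidiagonal.mem_antidiagonal.1 hp]
    congr 2
    push_cast
    ring
  rw [e]
  exact h.sigma fun n => hasSum_fintype _

/-- The coefficients may have any sign, so Tonelli is not available termwise; absolute summability
of the integrals replaces it. Nonnegativity of the new series is read off from the integral it
equals. -/
theorem lintegral_convolution_series (hα : 0 < α) (hA : 0 < A) (hB : 0 < B)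
    (ha : ∀ r, 0 < r → Summable (seriesTerm α A a r))
    (hb : ∀ r, 0 < r → Summable (seriesTerm α B b r))
    (ha0 : ∀ r, 0 < r → 0 ≤ ∑' i, seriesTerm α A a r i)
    (hb0 : ∀ r, 0 < r → 0 ≤ ∑' i, seriesTerm α B b r i) {z : ℝ} (hz : 0 < z) :
    (0 ≤ ∑' i, seriesTerm α (A + B)
        (fun n => ∑ p ∈ Finset.HasAntidiagonal.antidiagonal n, a p.1 * b p.2) z i) ∧
    ∫⁻ y in Set.Ioo 0 z, ENNReal.ofReal (∑' i, seriesTerm α A a y i) *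
        ENNReal.ofReal (∑' i, seriesTerm α B b (z - y) i) =
      ENNReal.ofReal (∑' i, seriesTerm α (A + B)
        (fun n => ∑ p ∈ Finset.HasAntidiagonal.antidiagonal n, a p.1 * b p.2) z i) := by
  set F : ℕ × ℕ → ℝ → ℝ := fun p y => a p.1 * b p.2 *
    (powerKernel (α * p.1 + A) y * powerKernel (α * p.2 + B) (z - y)) with hFdef
  have hposA := fun i : ℕ => hA.trans_le (exponent_ge (A := A) hα i)
  have hposB := fun i : ℕ => hB.trans_le (exponent_ge (A := B) hα i)
  have hF : ∀ p, Integrable (F p) (volume.restrict (Set.Ioo 0 z)) := fun p =>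
    (integrableOn_powerKernel_mul (hposA p.1) (hposB p.2) hz).const_mul _
  have hint : ∀ p, ∫ y in Set.Ioo 0 z, F p y =
      a p.1 * b p.2 * powerKernel (α * p.1 + A + (α * p.2 + B)) z := fun p => by
    rw [integral_const_mul, integral_powerKernel_mul (hposA p.1) (hposB p.2) hz]
  have hnorm : ∀ p, ∫ y in Set.Ioo 0 z, ‖F p y‖ =
      ‖a p.1 * b p.2 * powerKernel (α * p.1 + A + (α * p.2 + B)) z‖ := fun p => by
    rw [norm_mul, Real.norm_of_nonneg
      (powerKernel_nonneg (add_pos (hposA p.1) (hposB p.2)) hz.le),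
      ← integral_powerKernel_mul (hposA p.1) (hposB p.2) hz, ← integral_const_mul]
    refine setIntegral_congr_fun measurableSet_Ioo fun y hy => ?_
    simp only [hFdef]
    rw [norm_mul, Real.norm_of_nonneg (mul_nonneg (powerKernel_nonneg (hposA p.1) hy.1.le)
      (powerKernel_nonneg (hposB p.2) (sub_pos.2 hy.2).le))]
  have hmul : ∀ y ∈ Set.Ioo 0 z, ∀ p : ℕ × ℕ,
      seriesTerm α A a y p.1 * seriesTerm α B b (z - y) p.2 = F p y := fun y _ p => by
    simp only [seriesTerm, hFdef]; ring
  have hsum : ∀ y ∈ Set.Ioo 0 z, Summable fun p => F p y := fun y hy => by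
    simpa only [hmul y hy] using
      summable_mul_of_summable_norm (ha y hy.1).norm (hb _ (sub_pos.2 hy.2)).norm
  have hprod : ∀ y ∈ Set.Ioo 0 z, (∑' i, seriesTerm α A a y i) *
      (∑' i, seriesTerm α B b (z - y) i) = ∑' p, F p y := fun y hy => by
    rw [tsum_mul_tsum_of_summable_norm (ha y hy.1).norm (hb _ (sub_pos.2 hy.2)).norm]
    simp only [hmul y hy]
  have hnonneg : ∀ y ∈ Set.Ioo 0 z, 0 ≤ ∑' p, F p y := fun y hy => by
    rw [← hprod y hy]
    exact mul_nonneg (ha0 y hy.1) (hb0 _ (sub_pos.2 hy.2))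
  have hF' : Summable fun p => ∫ y in Set.Ioo 0 z, ‖F p y‖ := by
    simpa only [hnorm] using summable_convolution_terms hα hA hB hz (ha z hz) (hb z hz)
  have htot : ∑' p, ∫ y in Set.Ioo 0 z, F p y = ∑' i, seriesTerm α (A + B)
      (fun n => ∑ p ∈ Finset.HasAntidiagonal.antidiagonal n, a p.1 * b p.2) z i := by
    rw [(hasSum_convolution_terms hα hA hB hz (ha z hz) (hb z hz)).tsum_eq]
    simp only [hint]
  constructor
  · rw [← htot, (hasSum_integral_of_summable_integral_norm hF hF').tsum_eq]
    exact setIntegral_nonneg measurableSet_Ioo hnonneg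
  · rw [← htot, ← lintegral_ofReal_tsum hF hF' (ae_restrict_of_forall_mem measurableSet_Ioo hsum)
      (ae_restrict_of_forall_mem measurableSet_Ioo hnonneg)]
    refine setLIntegral_congr_fun measurableSet_Ioo fun y hy => ?_
    rw [← hprod y hy, ENNReal.ofReal_mul (ha0 y hy.1)]

end Convolution

/-! ### Random variables with a kernel series as density -/

/-- `X` is supported on `[0, ∞)` with density the everywhere convergent series
`∑ c i * r ^ (α i + A - 1) / Γ(α i + A)`. -/
structure HasSeriesDensity {Ω : Type*} [MeasurableSpace Ω] (P : Measure Ω) (X : Ω → ℝ)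
    (α A : ℝ) (c : ℕ → ℝ) : Prop where
  summable : ∀ r : ℝ, 0 < r → Summable (seriesTerm α A c r)
  density : HasPosDensity P X fun r => ∑' i, seriesTerm α A c r i

namespace HasSeriesDensity

variable {Ω : Type*} [MeasurableSpace Ω] {P : Measure Ω} {X Y : Ω → ℝ} {α A B : ℝ} {a b : ℕ → ℝ}

theorem add [IsProbabilityMeasure P] (hα : 0 < α) (hA : 0 < A) (hB : 0 < B)
    (hX : HasSeriesDensity P X α A a) (hY : HasSeriesDensity P Y α B b) (h : IndepFun X Y P) :
    HasSeriesDensity P (X + Y) α (A + B)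
      fun n => ∑ p ∈ Finset.HasAntidiagonal.antidiagonal n, a p.1 * b p.2 := by
  have := hX.density.hasPDF
  have := hY.density.hasPDF
  have key := fun z hz => lintegral_convolution_series hα hA hB hX.summable hY.summable
    hX.density.nonneg hY.density.nonneg (z := z) hz
  refine ⟨fun r hr => (hasSum_convolution_terms hα hA hB hr (hX.summable r hr)
    (hY.summable r hr)).summable, h.add_hasPDF, fun r hr => (key r hr).1, ?_⟩
  filter_upwards [h.pdf_add_eq_lconvolution_pdf (μ := volume)] with z hz
  rw [hz, lconvolution_def]
  -- The map `y ↦ -y + z` preserves Lebesgue measure, so an almost everywhere identity may be pulled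
  -- back along it.
  have hY' : ∀ᵐ y : ℝ, pdf Y P volume (-y + z) =
      ENNReal.ofReal (if 0 < -y + z then ∑' i, seriesTerm α B b (-y + z) i else 0) :=
    ((measurePreserving_add_right volume z).comp
      (Measure.measurePreserving_neg volume)).quasiMeasurePreserving.ae hY.density.pdf_ae
  have e : ∫⁻ y, pdf X P volume y * pdf Y P volume (-y + z) =
      ∫⁻ y, (Set.Ioo 0 z).indicator (fun y => ENNReal.ofReal (∑' i, seriesTerm α A a y i) *
        ENNReal.ofReal (∑' i, seriesTerm α B b (z - y) i)) y := by
    refine lintegral_congr_ae ?_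
    filter_upwards [hX.density.pdf_ae, hY'] with y h1 h2
    rw [h1, h2, show -y + z = z - y by ring]
    by_cases hy : y ∈ Set.Ioo 0 z
    · simp [hy, hy.1, hy.2]
    · rw [Set.indicator_of_notMem hy]
      by_cases hy0 : 0 < y
      · have : ¬ 0 < z - y := fun h => hy ⟨hy0, sub_pos.1 h⟩
        simp [this]
      · simp [hy0]
  rw [e, lintegral_indicator measurableSet_Ioo]
  split_ifs with h0
  · exact (key z h0).2
  · simp [Set.Ioo_eq_empty h0]

theorem cdf_eq [IsProbabilityMeasure P] (hα : 0 < α) (hA : 0 < A)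
    (hX : HasSeriesDensity P X α A a) {r : ℝ} (hr : 0 ≤ r) :
    Summable (fun i => a i * powerKernel (α * i + A + 1) r) ∧
      cdf (P.map X) r = ∑' i, a i * powerKernel (α * i + A + 1) r := by
  have hpos := fun i : ℕ => hA.trans_le (exponent_ge (A := A) hα i)
  have := hX.density.hasPDF
  have hm : AEMeasurable X P := HasPDF.aemeasurable' volume
  have : IsProbabilityMeasure (P.map X) := Measure.isProbabilityMeasure_map hm
  have e : P.map X (Set.Iic r) =
      ∫⁻ y in Set.Ioo 0 r, ENNReal.ofReal (∑' i, seriesTerm α A a y i) := by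
    rw [map_eq_setLIntegral_pdf X P volume measurableSet_Iic,
      setLIntegral_congr Iio_ae_eq_Iic.symm, ← lintegral_indicator measurableSet_Iio,
      ← lintegral_indicator measurableSet_Ioo]
    refine lintegral_congr_ae ?_
    filter_upwards [hX.density.pdf_ae] with y hy
    by_cases h0 : 0 < y <;> by_cases h1 : y < r <;> simp [Set.indicator, hy, h0, h1]
  -- At `r = 0` every term vanishes because its exponent `αi + A` is nonzero.
  rcases hr.eq_or_lt with rfl | hr
  · have h0 : ∀ i : ℕ, a i * powerKernel (α * i + A + 1) 0 = 0 := fun i => by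
      simp [powerKernel, Real.zero_rpow (hpos i).ne']
    simp [h0, summable_zero, cdf_eq_real, Measure.real, e]
  have hF : ∀ i, Integrable (fun y => seriesTerm α A a y i)
      (volume.restrict (Set.Ioo 0 r)) := fun i =>
    (integrableOn_powerKernel (hpos i) hr).const_mul _
  have hint : ∀ i, ∫ y in Set.Ioo 0 r, seriesTerm α A a y i =
      a i * powerKernel (α * i + A + 1) r := fun i => by
    simp only [seriesTerm]
    rw [integral_const_mul, integral_powerKernel (hpos i) hr]
  have hnorm : ∀ i, ∫ y in Set.Ioo 0 r, ‖seriesTerm α A a y i‖ =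
      ‖a i * powerKernel (α * i + A + 1) r‖ := fun i => by
    rw [norm_mul, Real.norm_of_nonneg (powerKernel_nonneg (by linarith [hpos i]) hr.le),
      ← integral_powerKernel (hpos i) hr, ← integral_const_mul]
    refine setIntegral_congr_fun measurableSet_Ioo fun y hy => ?_
    simp only [seriesTerm]
    rw [norm_mul, Real.norm_of_nonneg (powerKernel_nonneg (hpos i) hy.1.le)]
  -- Integration multiplies the `i`-th term by `r / (αi + A)`, which is at most `r / A`.
  have hs : Summable fun i => ‖a i * powerKernel (α * i + A + 1) r‖ := by
    refine ((hX.summable r hr).norm.mul_left (r / A)).of_nonneg_of_le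
      (fun _ => norm_nonneg _) fun i => ?_
    have h1 := powerKernel_nonneg (hpos i) hr.le
    have h2 : r / (α * i + A) ≤ r / A := div_le_div_of_nonneg_left hr.le hA (exponent_ge hα i)
    rw [powerKernel_add_one (hpos i) hr, seriesTerm, norm_mul, norm_mul, norm_mul,
      Real.norm_of_nonneg h1, Real.norm_of_nonneg (div_nonneg hr.le (hpos i).le)]
    calc _ = r / (α * i + A) * (‖a i‖ * powerKernel (α * i + A) r) := by ring
      _ ≤ _ := mul_le_mul_of_nonneg_right h2 (by positivity)
  have h0 : ∀ y ∈ Set.Ioo 0 r, 0 ≤ ∑' i, seriesTerm α A a y i := fun y hy =>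
    hX.density.nonneg y hy.1
  have hF' : Summable fun i => ∫ y in Set.Ioo 0 r, ‖seriesTerm α A a y i‖ := by
    simpa only [hnorm] using hs
  refine ⟨hs.of_norm, ?_⟩
  rw [cdf_eq_real, Measure.real, e, lintegral_ofReal_tsum hF hF'
    (ae_restrict_of_forall_mem measurableSet_Ioo fun y hy => hX.summable y hy.1)
    (ae_restrict_of_forall_mem measurableSet_Ioo h0), ENNReal.toReal_ofReal]
  · simp only [hint]
  · rw [(hasSum_integral_of_summable_integral_norm hF hF').tsum_eq]
    exact setIntegral_nonneg measurableSet_Ioo h0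

end HasSeriesDensity

/-! ### From mixture densities to kernel series -/

theorem sum_lam_eq_antidiagonal {T : ℝ} {φ : ℕ → ℝ} (x : ℝ) (n : ℕ) :
    ∑ p ∈ Finset.HasAntidiagonal.antidiagonal n,
        (φ p.1 / Real.Gamma (p.1 + T) * x ^ p.1) * ((-x) ^ p.2 / (p.2.factorial : ℝ)) =
      (∑ j ∈ Finset.range (n + 1),
        (-1) ^ (n - j) * φ j / (((n - j).factorial : ℝ) * Real.Gamma (j + T))) * x ^ n := by
  rw [Finset.Nat.sum_antidiagonal_eq_sum_range_succ
    (fun i j => (φ i / Real.Gamma (i + T) * x ^ i) * ((-x) ^ j / (j.factorial : ℝ))),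
    Finset.sum_mul]
  refine Finset.sum_congr rfl fun j hj => ?_
  rw [neg_pow x, ← Nat.add_sub_of_le (Nat.lt_succ_iff.1 (Finset.mem_range.1 hj)), pow_add,
    Nat.add_sub_cancel_left]
  simp only [div_eq_mul_inv, mul_inv]
  ring

theorem mixtureTerm_eq {α T rhat r : ℝ} (φ : ℕ → ℝ) (hr : 0 < r)
    (hrhat : 0 < rhat) (i : ℕ) :
    mixtureTerm α T rhat φ r i = r ^ (α * T - 1) / rhat ^ (α * T) *
      (φ i / Real.Gamma (i + T) * (r ^ α / rhat ^ α) ^ i) := by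
  have e1 : r ^ (α * (i + T) - 1) = r ^ (α * T - 1) * (r ^ α) ^ i := by
    rw [← Real.rpow_natCast, ← Real.rpow_mul hr.le, ← Real.rpow_add hr]; ring_nf
  have e2 : rhat ^ (α * (i + T)) = rhat ^ (α * T) * (rhat ^ α) ^ i := by
    rw [← Real.rpow_natCast, ← Real.rpow_mul hrhat.le, ← Real.rpow_add hrhat]; ring_nf
  rw [mixtureTerm, e1, e2, div_pow]
  simp only [div_eq_mul_inv, mul_inv]
  ring

/-- With `x = r ^ α / rhat ^ α`, the sum is the Cauchy product of the mixture series with that of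
`exp (-x)`. The factor `Γ(α(n + T))` in `lam` is there to cancel the one in the kernel. -/
theorem seriesTerm_lam {α T rhat r : ℝ} (φ : ℕ → ℝ) (hα : 0 < α) (hT : 0 < T) (hr : 0 < r)
    (hrhat : 0 < rhat) (n : ℕ) :
    seriesTerm α (α * T) (fun i => α / rhat ^ (α * T) * lam α T rhat φ i) r n =
      α * (r ^ (α * T - 1) / rhat ^ (α * T)) *
        ∑ p ∈ Finset.HasAntidiagonal.antidiagonal n,
          (φ p.1 / Real.Gamma (p.1 + T) * (r ^ α / rhat ^ α) ^ p.1) *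
            ((-(r ^ α / rhat ^ α)) ^ p.2 / (p.2.factorial : ℝ)) := by
  have hΓ : Real.Gamma (α * (n + T)) ≠ 0 := (Real.Gamma_pos_of_pos (by positivity)).ne'
  have e1 : r ^ (α * n + α * T - 1) = r ^ (α * T - 1) * (r ^ α) ^ n := by
    rw [← Real.rpow_natCast, ← Real.rpow_mul hr.le, ← Real.rpow_add hr]; ring_nf
  have e2 : rhat ^ (α * n) = (rhat ^ α) ^ n := by
    rw [← Real.rpow_natCast, ← Real.rpow_mul hrhat.le]
  rw [sum_lam_eq_antidiagonal, seriesTerm, lam, powerKernel, e1, e2, ← mul_add, div_pow]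
  field_simp

theorem IsMixture.hasSeriesDensity {Ω : Type*} [MeasurableSpace Ω] {P : Measure Ω} {X : Ω → ℝ}
    {α T rhat : ℝ} {φ : ℕ → ℝ} (hα : 0 < α) (hT : 0 < T) (hrhat : 0 < rhat)
    (h : IsMixture P X α T rhat φ) :
    HasSeriesDensity P X α (α * T) fun i => α / rhat ^ (α * T) * lam α T rhat φ i := by
  have hu : ∀ r, 0 < r →
      Summable fun i : ℕ => φ i / Real.Gamma (i + T) * (r ^ α / rhat ^ α) ^ i := fun r hr => by
    have h1 := h.summable r hr
    simp only [funext (mixtureTerm_eq φ hr hrhat)] at h1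
    refine (summable_mul_left_iff (ne_of_gt ?_)).1 h1
    positivity
  have hs : ∀ r, 0 < r → Summable (seriesTerm α (α * T)
      (fun i => α / rhat ^ (α * T) * lam α T rhat φ i) r) := fun r hr => by
    rw [funext (seriesTerm_lam φ hα hT hr hrhat)]
    exact (summable_norm_sum_mul_antidiagonal_of_summable_norm (hu r hr).norm
      (Real.summable_pow_div_factorial _).norm).of_norm.mul_left _
  have he : ∀ r, 0 < r → mixtureDensity α T rhat φ r = ∑' i, seriesTerm α (α * T)
      (fun i => α / rhat ^ (α * T) * lam α T rhat φ i) r i := fun r hr => by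
    rw [tsum_congr (seriesTerm_lam φ hα hT hr hrhat), tsum_mul_left,
      ← tsum_mul_tsum_eq_tsum_sum_antidiagonal_of_summable_norm (hu r hr).norm
      (Real.summable_pow_div_factorial _).norm, mixtureDensity,
      tsum_congr (mixtureTerm_eq φ hr hrhat), tsum_mul_left, Real.exp_eq_exp_ℝ,
      NormedSpace.exp_eq_tsum_div]
    ring
  refine ⟨hs, h.density.hasPDF, fun r hr => he r hr ▸ h.density.nonneg r hr, ?_⟩
  refine h.density.pdf_ae.trans (Filter.Eventually.of_forall fun r => ?_)
  simp only
  split_ifs with hr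
  · rw [he r hr]
  · rfl

/-! ### The recursions as identities of formal power series -/

open PowerSeries in
-- The recursion is the degree `h` coefficient of this identity, solved for the term `η 0 * phiCoeff
-- η h`.
theorem mk_mul_mk_phiCoeff {η : ℕ → ℝ} (h0 : η 0 ≠ 0) :
    mk η * mk (phiCoeff η) = derivative ℝ (mk η) := by
  ext h
  rw [coeff_derivative, coeff_mul, coeff_mk, Finset.Nat.sum_antidiagonal_eq_sum_range_succ
    (fun i j => coeff i (mk η) * coeff j (mk (phiCoeff η))), Finset.sum_range_succ']
  simp only [coeff_mk, Nat.sub_zero]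
  have e : phiCoeff η h = 1 / η 0 * (((h : ℝ) + 1) * η (h + 1) -
      ∑ t ∈ Finset.range h, η (t + 1) * phiCoeff η (h - (t + 1))) := by
    rw [phiCoeff, Fin.sum_univ_eq_sum_range (fun t => η (t + 1) * phiCoeff η (h - (t + 1)))]
  rw [e]
  field_simp
  ring

open PowerSeries in
theorem prod_mk_mul_sum_phiCoeff {ι : Type*} (s : Finset ι) {η : ι → ℕ → ℝ}
    (h0 : ∀ i ∈ s, η i 0 ≠ 0) :
    (∏ i ∈ s, mk (η i)) * ∑ i ∈ s, mk (phiCoeff (η i)) = derivative ℝ (∏ i ∈ s, mk (η i)) := by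
  classical
  induction s using Finset.induction_on with
  | empty => simp
  | insert i s hi ih =>
    rw [Finset.prod_insert hi, Finset.sum_insert hi, Derivation.leibniz,
      ← ih fun j hj => h0 j (Finset.mem_insert_of_mem hj),
      ← mk_mul_mk_phiCoeff (h0 i (Finset.mem_insert_self i s)), smul_eq_mul, smul_eq_mul]
    ring

open PowerSeries in
-- The product `G` satisfies `G' = G * ∑ ℓ, mk (phiCoeff (η ℓ))`. Its degree `n` coefficient
-- expresses `(n + 1) * G_{n+1}` through lower coefficients, which is the defining recursion of
-- `deltaCoeff`.
theorem mk_deltaCoeff {L : ℕ} {η : Fin L → ℕ → ℝ} (h0 : ∀ ℓ, η ℓ 0 ≠ 0) :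
    mk (deltaCoeff η) = ∏ ℓ, mk (η ℓ) := by
  ext n
  rw [coeff_mk]
  induction n using Nat.strong_induction_on with
  | _ n ih =>
    cases n with
    | zero =>
      rw [deltaCoeff_zero, coeff_zero_eq_constantCoeff_apply, map_prod]
      simp [← coeff_zero_eq_constantCoeff_apply]
    | succ n =>
      have key := congrArg (coeff n) (prod_mk_mul_sum_phiCoeff Finset.univ fun ℓ _ => h0 ℓ)
      rw [coeff_derivative, mul_comm (∏ ℓ, mk (η ℓ)), coeff_mul,
        Finset.Nat.sum_antidiagonal_eq_sum_range_succ (fun i j =>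
          coeff i (∑ ℓ, mk (phiCoeff (η ℓ))) * coeff j (∏ ℓ, mk (η ℓ)))] at key
      rw [deltaCoeff, Fin.sum_univ_eq_sum_range
        (fun h => deltaCoeff η (n - h) * ∑ ℓ, phiCoeff (η ℓ) h), one_div_mul_eq_div,
        div_eq_iff (by positivity), ← key]
      refine Finset.sum_congr rfl fun h _ => ?_
      rw [ih (n - h) (by omega), map_sum, mul_comm]
      simp only [coeff_mk]

theorem lam_zero_ne_zero {α T rhat : ℝ} {φ : ℕ → ℝ} (hα : 0 < α) (hT : 0 < T) (hφ : φ 0 ≠ 0) :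
    lam α T rhat φ 0 ≠ 0 := by
  have h1 := (Real.Gamma_pos_of_pos (mul_pos hα hT)).ne'
  have h2 := (Real.Gamma_pos_of_pos hT).ne'
  simp [lam, h1, h2, hφ]

open PowerSeries in
/-- The sum of independent variables with series densities has a series density, whose
coefficient sequence is the product of those of the summands as power series. -/
theorem HasSeriesDensity.sum {Ω ι : Type*} [MeasurableSpace Ω] {P : Measure Ω}
    [IsProbabilityMeasure P] {X : ι → Ω → ℝ} {α : ℝ} {A : ι → ℝ} {a : ι → ℕ → ℝ} (hα : 0 < α)
    (hA : ∀ i, 0 < A i) (hX : ∀ i, HasSeriesDensity P (X i) α (A i) (a i)) (h : iIndepFun X P)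
    {s : Finset ι} (hs : s.Nonempty) :
    HasSeriesDensity P (∑ i ∈ s, X i) α (∑ i ∈ s, A i)
      fun n => coeff n (∏ i ∈ s, PowerSeries.mk (a i)) := by
  induction hs using Finset.Nonempty.cons_induction with
  | singleton i => simpa using hX i
  | cons i s hi hs ih =>
    have hm : ∀ i, AEMeasurable (X i) P := fun i =>
      have := (hX i).density.hasPDF
      HasPDF.aemeasurable' volume
    have hind := (h.indepFun_finsetSum_of_notMem₀ hm hi).symm
    have := (hX i).add hα (hA i) (Finset.sum_pos (fun i _ => hA i) hs) ih hind
    simpa only [Finset.sum_cons, Finset.prod_cons, coeff_mul, coeff_mk] using this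

end AlphaMu

end

/-! ### The density and distribution function of the sum -/

theorem proposition2 {Ω : Type*} [MeasurableSpace Ω] (P : MeasureTheory.Measure Ω)
    [MeasureTheory.IsProbabilityMeasure P]
    (L : ℕ) (hL : 1 ≤ L)
    (α : ℝ) (hα : 0 < α)
    (T : Fin L → ℝ) (hT : ∀ ℓ, 0 < T ℓ)
    (rhat : Fin L → ℝ) (hrhat : ∀ ℓ, 0 < rhat ℓ)
    (φ : Fin L → ℕ → ℝ) (hφ : ∀ ℓ, φ ℓ 0 ≠ 0)
    (R : Fin L → Ω → ℝ)
    (hR : ∀ ℓ, AlphaMu.IsMixture P (R ℓ) α (T ℓ) (rhat ℓ) (φ ℓ))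
    (hindep : ProbabilityTheory.iIndepFun R P)
    (δ : ℕ → ℝ)
    (hδ : δ = AlphaMu.deltaCoeff fun ℓ => AlphaMu.lam α (T ℓ) (rhat ℓ) (φ ℓ)) :
    (∀ r : ℝ, 0 < r → Summable fun i : ℕ =>
      δ i * r ^ (-1 + α * i + α * ∑ ℓ, T ℓ) / Real.Gamma (i * α + α * ∑ ℓ, T ℓ)) ∧
    AlphaMu.HasPosDensity P (fun ω => ∑ ℓ, R ℓ ω) (fun r =>
      α ^ L * (∏ ℓ, 1 / rhat ℓ ^ (α * T ℓ)) *
        ∑' i : ℕ,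
          δ i * r ^ (-1 + α * i + α * ∑ ℓ, T ℓ) / Real.Gamma (i * α + α * ∑ ℓ, T ℓ)) ∧
    (∀ r : ℝ, 0 ≤ r →
      (Summable fun i : ℕ =>
        δ i * r ^ (α * i + α * ∑ ℓ, T ℓ) / Real.Gamma (1 + i * α + α * ∑ ℓ, T ℓ)) ∧
      ProbabilityTheory.cdf (P.map fun ω => ∑ ℓ, R ℓ ω) r =
        α ^ L * (∏ ℓ, 1 / rhat ℓ ^ (α * T ℓ)) *
          ∑' i : ℕ,
            δ i * r ^ (α * i + α * ∑ ℓ, T ℓ) / Real.Gamma (1 + i * α + α * ∑ ℓ, T ℓ)) := by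
  subst hδ
  set C : Fin L → ℝ := fun ℓ => α / rhat ℓ ^ (α * T ℓ) with hC
  set η : Fin L → ℕ → ℝ := fun ℓ => AlphaMu.lam α (T ℓ) (rhat ℓ) (φ ℓ) with hη
  have hη0 : ∀ ℓ, η ℓ 0 ≠ 0 := fun ℓ => AlphaMu.lam_zero_ne_zero hα (hT ℓ) (hφ ℓ)
  have : Nonempty (Fin L) := Fin.pos_iff_nonempty.1 hL
  have hTpos : 0 < ∑ ℓ, T ℓ := Finset.sum_pos (fun ℓ _ => hT ℓ) Finset.univ_nonempty
  have hpos : 0 < α * ∑ ℓ, T ℓ := mul_pos hα hTpos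
  have hCprod : ∏ ℓ, C ℓ = α ^ L * ∏ ℓ, 1 / rhat ℓ ^ (α * T ℓ) := by
    simp [hC, div_eq_mul_inv, Finset.prod_mul_distrib]
  -- Each factor carries a scalar `C ℓ`; their product is the prefactor, leaving `deltaCoeff` of the
  -- unscaled sequences.
  have hcoeff : ∀ n, PowerSeries.coeff n (∏ ℓ, PowerSeries.mk fun i => C ℓ * η ℓ i) =
      (α ^ L * ∏ ℓ, 1 / rhat ℓ ^ (α * T ℓ)) * AlphaMu.deltaCoeff η n := fun n => by
    have e : ∀ ℓ, (PowerSeries.mk fun i => C ℓ * η ℓ i) =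
        PowerSeries.C (C ℓ) * PowerSeries.mk (η ℓ) := fun ℓ => by
      ext i; simp
    simp only [e]
    rw [Finset.prod_mul_distrib, ← map_prod, PowerSeries.coeff_C_mul, hCprod,
      ← AlphaMu.mk_deltaCoeff hη0, PowerSeries.coeff_mk]
  -- Needed to cancel the prefactor from the summability statements.
  have hKpos : α ^ L * ∏ ℓ, 1 / rhat ℓ ^ (α * T ℓ) ≠ 0 := by
    rw [← hCprod]
    exact Finset.prod_ne_zero_iff.2 fun ℓ _ =>
      (div_pos hα (Real.rpow_pos_of_pos (hrhat ℓ) _)).ne'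
  have main := AlphaMu.HasSeriesDensity.sum hα (fun ℓ => mul_pos hα (hT ℓ))
    (fun ℓ => (hR ℓ).hasSeriesDensity hα (hT ℓ) (hrhat ℓ)) hindep Finset.univ_nonempty
  simp only [← Finset.mul_sum] at main
  have hX : (∑ ℓ, R ℓ) = fun ω => ∑ ℓ, R ℓ ω := by ext ω; simp
  rw [hX, show (fun n => PowerSeries.coeff n (∏ ℓ, PowerSeries.mk fun i =>
    α / rhat ℓ ^ (α * T ℓ) * AlphaMu.lam α (T ℓ) (rhat ℓ) (φ ℓ) i)) = _ from funext hcoeff] at main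
  set K := α ^ L * ∏ ℓ, 1 / rhat ℓ ^ (α * T ℓ)
  have hterm : ∀ r : ℝ, AlphaMu.seriesTerm α (α * ∑ ℓ, T ℓ)
      (fun n => K * AlphaMu.deltaCoeff η n) r = fun i => K * (AlphaMu.deltaCoeff η i *
        r ^ (-1 + α * i + α * ∑ ℓ, T ℓ) / Real.Gamma (i * α + α * ∑ ℓ, T ℓ)) := fun r => by
    funext i
    rw [AlphaMu.seriesTerm, AlphaMu.powerKernel, mul_comm (i : ℝ) α,
      show α * i + α * ∑ ℓ, T ℓ - 1 = -1 + α * i + α * ∑ ℓ, T ℓ by ring]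
    ring
  have hdens : (fun r : ℝ => ∑' i, AlphaMu.seriesTerm α (α * ∑ ℓ, T ℓ)
      (fun n => K * AlphaMu.deltaCoeff η n) r i) = fun r => K * ∑' i : ℕ,
        (AlphaMu.deltaCoeff η i * r ^ (-1 + α * i + α * ∑ ℓ, T ℓ) /
          Real.Gamma (i * α + α * ∑ ℓ, T ℓ)) := by
    funext r
    rw [hterm, tsum_mul_left]
  refine ⟨fun r hr => ?_, hdens ▸ main.density, fun r hr => ?_⟩
  · have h := main.summable r hr
    rw [hterm] at h
    exact (summable_mul_left_iff hKpos).1 h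
  · have e : ∀ i : ℕ, K * AlphaMu.deltaCoeff η i *
        AlphaMu.powerKernel (α * i + α * ∑ ℓ, T ℓ + 1) r =
        K * (AlphaMu.deltaCoeff η i * r ^ (α * i + α * ∑ ℓ, T ℓ) /
          Real.Gamma (1 + i * α + α * ∑ ℓ, T ℓ)) := fun i => by
      rw [AlphaMu.powerKernel, add_sub_cancel_right,
        show 1 + i * α + α * ∑ ℓ, T ℓ = α * i + α * ∑ ℓ, T ℓ + 1 by ring]
      ring
    have h := main.cdf_eq hα hpos hr
    simp only [e] at h
    refine ⟨(summable_mul_left_iff hKpos).1 h.1, ?_⟩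
    rw [h.2, tsum_mul_left]
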